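/- A \emph{two-player win-lose coordination game} $G$ consists of two disjoint finite non-empty choice sets $C_1, C_2$ and a set $W_G\subseteq C_1\times C_2$ of winning profiles such that every choice belongs to some winning profile. In the choice matching game $\mathrm{CM}_m$ both players have $m$ choices, and the winning profiles are $m$ pairwise disjoint pairs of choices. In a repeated play the players choose simultaneously and independently in each round, knowing the whole history of the earlier rounds, until a winning profile is chosen for the first time. A stage $(G,\mathcal H)$ is a game with a finite sequence $\mathcal H$ of choice profiles, its history; it is final if $\mathcal H$ contains a winning profile. A \emph{protocol} assigns to every stage $(G,\mathcal H)$ and every player $i$ a probability distribution on $C_i$. It is \emph{structural} if it is invariant under renamings, i.e. under all bijections between the domains of two games that carry choice sets to choice sets (possibly exchanging the two players), the winning relation to the winning relation, and the history to the history round by round. All protocols below are structural. The \emph{expected coordination time} (ECT) of a protocol in $G$ is the expected value in $[0,\infty]$ of the number of rounds until coordination when both players follow the protocol from the empty history. A protocol $\pi$ is \emph{ECT-optimal} for $G$ if no structural protocol has a smaller ECT in $G$. It is \emph{uniquely ECT-optimal} for $G$ if moreover every ECT-optimal protocol $\pi'$ for $G$ prescribes the same distributions as $\pi$ to both players in every non-final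 stage of $G$ that is reached with positive probability when both players follow $\pi$. The \emph{wait-or-move protocol} $\mathrm{WM}$ for two-player games is the following. If each player has so far selected only a single choice (possibly several times), then a player repeats his own choice with probability $\frac12$, and with the remaining probability $\frac12$ he picks, uniformly, one of the choices that form a winning profile with the choice of the other player. If each player has so far selected exactly two choices, then a player picks each of his own two earlier choices with probability $\frac12$. In every other non-final stage, in particular in the first round, he picks uniformly among all his choices. \textbf{Theorem.} For every $m\ge 6$, the protocol $\mathrm{WM}$ is uniquely ECT-optimal for $\mathrm{CM}_m$, and its ECT in $\mathrm{CM}_m$, which is thus the optimal one, equals $3-\frac2m$. -/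

import Mathlib

open scoped ENNReal

/-- An `n`-player win-lose coordination game. The choice sets of the players are given as a family
of types, so they are automatically pairwise disjoint; the domain of the game is their disjoint
union. There are no surely losing choices. -/
structure WLCGame (n : ℕ) where
  /-- `Choice i` is the finite non-empty set of choices of player `i`. -/
  Choice : Fin n → Type
  [fintypeChoice : ∀ i, Fintype (Choice i)]
  [nonemptyChoice : ∀ i, Nonempty (Choice i)]
  /-- The set of winning choice profiles. -/
  Win : Set (∀ i, Choice i)
  noLosingChoice : ∀ (i : Fin n) (c : Choice i), ∃ σ ∈ Win, σ i = c

attribute [instance] WLCGame.fintypeChoice WLCGame.nonemptyChoice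

namespace WLCGame

variable {n : ℕ}

/-- A choice profile: one choice for each player. -/
abbrev Profile (G : WLCGame n) : Type := ∀ i, G.Choice i

/-- The history of the first `k` rounds of a repeated play: the list of the `k` profiles that were
chosen, the most recent round at the head. A stage of a repeated play of `G` is the game `G`
together with a history; the initial stage has the empty history. -/
abbrev History (G : WLCGame n) : Type := List G.Profile

/-- The players have coordinated in some round of the history, so the play is over. -/
def IsFinal (G : WLCGame n) (H : G.History) : Prop := ∃ σ ∈ H, σ ∈ G.Win

/-- A renaming between the stages `(G, H)` and `(G', H')`: a permutation `β` of the players and a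
bijection between the domains that takes the choices of player `β i` in `G` to the choices
of player `i` in `G'`, and that respects the winning relation and each round of the history. -/
structure Renaming (G G' : WLCGame n) (H : G.History) (H' : G'.History) where
  β : Equiv.Perm (Fin n)
  toEquiv : ∀ i, G.Choice (β i) ≃ G'.Choice i
  win_iff : ∀ σ : G.Profile, σ ∈ G.Win ↔ (fun i => toEquiv i (σ (β i))) ∈ G'.Win
  history_eq : H' = H.map fun σ i => toEquiv i (σ (β i))

end WLCGame

/-- The choice matching game with `n` players and `m` choices for each player: its winning profiles
are the `m` pairwise disjoint profiles in which all the players pick the same row. -/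
def choiceMatching (n m : ℕ) (hm : 0 < m) : WLCGame n where
  Choice := fun _ => Fin m
  nonemptyChoice := fun _ => ⟨⟨0, hm⟩⟩
  Win := {σ | ∃ a : Fin m, ∀ i, σ i = a}
  noLosingChoice := fun _ c => ⟨fun _ => c, ⟨c, fun _ => rfl⟩, rfl⟩

/-- A protocol (for `n`-player games): a probability distribution on the choices of player `i`
for every stage `(G, H)` and every player `i`. -/
structure Protocol (n : ℕ) where
  prob : ∀ (G : WLCGame n) (_ : G.History) (i : Fin n), G.Choice i → ℝ
  prob_nonneg : ∀ (G : WLCGame n) (H : G.History) (i : Fin n) (c : G.Choice i),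
    0 ≤ prob G H i c
  sum_prob : ∀ (G : WLCGame n) (H : G.History) (i : Fin n), ∑ c, prob G H i c = 1

namespace Protocol

variable {n : ℕ}

/-- A protocol is structural if it is indifferent with respect to renamings. -/
def IsStructural (P : Protocol n) : Prop :=
  ∀ (G G' : WLCGame n) (H : G.History) (H' : G'.History) (r : G.Renaming G' H H')
    (i : Fin n) (c : G.Choice (r.β i)),
    P.prob G H (r.β i) c = P.prob G' H' i (r.toEquiv i c)

/-- The probability that the profile `σ` is chosen in the next round after the stage `(G, H)`
when all players follow `P`, each of them choosing independently of the others. -/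
noncomputable def profileProb (P : Protocol n) (G : WLCGame n) (H : G.History)
    (σ : G.Profile) : ℝ :=
  ∏ i, P.prob G H i (σ i)

open Classical in
/-- The probability that, when all players follow `P` from the stage `(G, H)` on, the number of
further rounds until coordination is exactly `k`. -/
noncomputable def timeProb (P : Protocol n) (G : WLCGame n) : ℕ → G.History → ℝ
  | 0, H => if G.IsFinal H then 1 else 0
  | k + 1, H => if G.IsFinal H then 0 else
      ∑ σ : G.Profile, P.profileProb G H σ * timeProb P G k (σ :: H)

/-- The expected coordination time from the stage `(G, H)` with `P`: the expected value of the
number of rounds until coordination. This number is `∞` on the plays that never coordinate, whose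
probability is the mass missing from the finite values. -/
noncomputable def ect (P : Protocol n) (G : WLCGame n) (H : G.History) : ℝ≥0∞ :=
  ∑' k : ℕ, (k : ℝ≥0∞) * ENNReal.ofReal (P.timeProb G k H) +
    ∞ * (1 - ∑' k : ℕ, ENNReal.ofReal (P.timeProb G k H))

/-- The stages of `G` that occur with positive probability in a repeated play, which goes on until
the first coordination, when all players follow `P`. -/
inductive Reachable (P : Protocol n) (G : WLCGame n) : G.History → Prop
  | initial : Reachable P G []
  | step (H : G.History) (σ : G.Profile) : Reachable P G H → ¬ G.IsFinal H →
      0 < P.profileProb G H σ → Reachable P G (σ :: H)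

/-- `P` is ECT-optimal for `G`: it is structural and gives the minimum expected coordination time
in `G` among all structural protocols. -/
def IsECTOptimal (P : Protocol n) (G : WLCGame n) : Prop :=
  P.IsStructural ∧ ∀ Q : Protocol n, Q.IsStructural → P.ect G [] ≤ Q.ect G []

/-- `P` is uniquely ECT-optimal for `G`: it is ECT-optimal, and every ECT-optimal protocol agrees
with `P` on all stages of `G` that are reachable with `P` and in which play still continues. -/
def IsUniquelyECTOptimal (P : Protocol n) (G : WLCGame n) : Prop :=
  P.IsECTOptimal G ∧ ∀ Q : Protocol n, Q.IsECTOptimal G →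
    ∀ H : G.History, P.Reachable G H → ¬ G.IsFinal H →
      ∀ (i : Fin n) (c : G.Choice i), Q.prob G H i c = P.prob G H i c

end Protocol

namespace WaitOrMove

open Classical in
/-- The set of choices that player `i` has selected in the history. -/
noncomputable def chosen {n : ℕ} (G : WLCGame n) (H : G.History) (i : Fin n) :
    Finset (G.Choice i) :=
  {c | ∃ σ ∈ H, σ i = c}

open Classical in
/-- The choices of player `i` in a two-player game that coordinate with some earlier choice of the
other player `i.rev`. -/
noncomputable def coordinating (G : WLCGame 2) (H : G.History) (i : Fin 2) :
    Finset (G.Choice i) :=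
  {c | ∃ d ∈ chosen G H i.rev, ∃ σ ∈ G.Win, σ i = c ∧ σ i.rev = d}

open Classical in
/-- The distribution that wait-or-move prescribes to player `i`. If both players have selected only
a single choice, player `i` repeats the own choice with probability `1/2`, and the other half
is shared equally by the choices that coordinate with the choice of the other player (as long as
the play continues, the own choice is not among these). If both players have selected exactly two
choices, player `i` picks each of the two own choices with probability `1/2`. In all other cases,
in particular in the first round, player `i` picks uniformly among all choices. -/
noncomputable def prob (G : WLCGame 2) (H : G.History) (i : Fin 2) (c : G.Choice i) : ℝ :=
  if ∀ j, (chosen G H j).card = 1 then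
    (if c ∈ chosen G H i then 1 / 2 else 0) +
      (if c ∈ coordinating G H i then 1 / (2 * ((coordinating G H i).card : ℝ)) else 0)
  else if ∀ j, (chosen G H j).card = 2 then
    (if c ∈ chosen G H i then 1 / 2 else 0)
  else 1 / (Fintype.card (G.Choice i) : ℝ)

theorem prob_nonneg (G : WLCGame 2) (H : G.History) (i : Fin 2) (c : G.Choice i) :
    0 ≤ prob G H i c := by
  unfold prob
  split_ifs <;> positivity

theorem sum_prob (G : WLCGame 2) (H : G.History) (i : Fin 2) : ∑ c, prob G H i c = 1 := by
  classical
  unfold prob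
  split_ifs with h1 h2
  · have hne : (coordinating G H i).Nonempty := by
      obtain ⟨d, hd⟩ := Finset.card_pos.mp (by rw [h1 i.rev]; exact one_pos)
      obtain ⟨σ, hσ, hd'⟩ := G.noLosingChoice i.rev d
      exact ⟨σ i, Finset.mem_filter.mpr ⟨Finset.mem_univ _, d, hd, σ, hσ, rfl, hd'⟩⟩
    have hpos : (0 : ℝ) < (coordinating G H i).card := by exact_mod_cast hne.card_pos
    rw [Finset.sum_add_distrib, Finset.sum_ite_mem, Finset.sum_ite_mem]
    simp only [Finset.univ_inter, Finset.sum_const, nsmul_eq_mul, h1 i]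
    field_simp
    norm_num
  · rw [Finset.sum_ite_mem]
    simp only [Finset.univ_inter, Finset.sum_const, nsmul_eq_mul, h2 i]
    norm_num
  · have hpos : (0 : ℝ) < Fintype.card (G.Choice i) := by exact_mod_cast Fintype.card_pos
    simp only [Finset.sum_const, nsmul_eq_mul, Finset.card_univ]
    field_simp

end WaitOrMove

/-- The wait-or-move protocol for repeated two-player games. -/
noncomputable def waitOrMove : Protocol 2 where
  prob := WaitOrMove.prob
  prob_nonneg := WaitOrMove.prob_nonneg
  sum_prob := WaitOrMove.sum_prob

/-! The proof is a potential argument. Call a non-final stage symmetric if an involution of the rows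
that moves exactly the touched rows, combined with exchanging the players, preserves the history.
There a structural protocol must give player 1 the mirror image of player 0's distribution, and it
must be uniform on untouched rows. A round then coordinates, stays symmetric (a touched mirror pair,
or two distinct untouched rows), or breaks the symmetry. The potential `lowerBound` is 0 at final
stages, `symmetricBound u` at symmetric stages with `u` untouched rows, and 1 elsewhere. By
`IsSymmetry.lowerBound_add_le` it is at most 1 plus its mean after one round, with explicit
nonnegative slack at symmetric stages; `Protocol.ofReal_le_ect` turns this into a lower bound for
the ECT. The first round is forced to be uniform. If it fails, `m - 2 ≥ 4` rows are untouched and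
the potential is 2, which gives `1 + 2 * (1 - 1/m) = 3 - 2/m`. Wait-or-move attains this, since
after a failed first round both players toss fair coins between the two touched rows. For
uniqueness, optimality makes the slack vanish: no weight on untouched rows and equal weight on the
two touched ones (`IsPairHistory.eq_of_ect_eq`). Tightness passes to the successors by
`Protocol.ect_cons_eq`. -/

/-! ### Renamings and the structurality of wait-or-move. -/

namespace WLCGame

variable {n : ℕ}

theorem Renaming.exists_preimage {G G' : WLCGame n} {H : G.History} {H' : G'.History}
    (r : G.Renaming G' H H') (σ' : G'.Profile) :
    ∃ σ : G.Profile, (fun i => r.toEquiv i (σ (r.β i))) = σ' := by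
  refine ⟨Equiv.piCongrLeft _ r.β fun i => (r.toEquiv i).symm (σ' i), ?_⟩
  funext i
  rw [Equiv.piCongrLeft_apply_apply, Equiv.apply_symm_apply]

end WLCGame

namespace WaitOrMove

open WLCGame

theorem mem_chosen {n : ℕ} {G : WLCGame n} {H : G.History} {i : Fin n} {c : G.Choice i} :
    c ∈ chosen G H i ↔ ∃ σ ∈ H, σ i = c := by
  simp [chosen]

theorem mem_coordinating {G : WLCGame 2} {H : G.History} {i : Fin 2} {c : G.Choice i} :
    c ∈ coordinating G H i ↔ ∃ ρ ∈ H, ∃ σ ∈ G.Win, σ i = c ∧ σ i.rev = ρ i.rev := by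
  simp only [coordinating, mem_chosen, Finset.mem_filter, Finset.mem_univ, true_and]
  constructor
  · rintro ⟨d, ⟨ρ, hρ, rfl⟩, σ, hσ, h1, h2⟩
    exact ⟨ρ, hρ, σ, hσ, h1, h2⟩
  · rintro ⟨ρ, hρ, σ, hσ, h1, h2⟩
    exact ⟨_, ⟨ρ, hρ, rfl⟩, σ, hσ, h1, h2⟩

theorem chosen_renaming {n : ℕ} {G G' : WLCGame n} {H : G.History} {H' : G'.History}
    (r : G.Renaming G' H H') (i : Fin n) :
    chosen G' H' i = (chosen G H (r.β i)).map (r.toEquiv i).toEmbedding := by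
  ext c
  simp only [mem_chosen, r.history_eq, List.mem_map, Finset.mem_map, Equiv.coe_toEmbedding]
  constructor
  · rintro ⟨_, ⟨σ, hσ, rfl⟩, rfl⟩
    exact ⟨_, ⟨σ, hσ, rfl⟩, rfl⟩
  · rintro ⟨_, ⟨σ, hσ, rfl⟩, rfl⟩
    exact ⟨_, ⟨σ, hσ, rfl⟩, rfl⟩

/-- The symmetric group on two players is abelian; this lets "the other player" be transported along
a renaming. -/
theorem perm_rev (β : Equiv.Perm (Fin 2)) (i : Fin 2) : (β i).rev = β i.rev := by
  revert β i; decide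

theorem coordinating_renaming {G G' : WLCGame 2} {H : G.History} {H' : G'.History}
    (r : G.Renaming G' H H') (i : Fin 2) :
    coordinating G' H' i = (coordinating G H (r.β i)).map (r.toEquiv i).toEmbedding := by
  ext c
  simp only [mem_coordinating, r.history_eq, List.mem_map, Finset.mem_map,
    Equiv.coe_toEmbedding]
  constructor
  · rintro ⟨_, ⟨ρ, hρ, rfl⟩, σ', hσ', rfl, h⟩
    obtain ⟨σ, rfl⟩ := r.exists_preimage σ'
    exact ⟨σ (r.β i), ⟨ρ, hρ, σ, (r.win_iff σ).2 hσ', rfl,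
      perm_rev r.β i ▸ (r.toEquiv _).injective h⟩, rfl⟩
  · rintro ⟨_, ⟨ρ, hρ, σ, hσ, rfl, h⟩, rfl⟩
    exact ⟨_, ⟨ρ, hρ, rfl⟩, _, (r.win_iff σ).1 hσ, rfl, congrArg _ (perm_rev r.β i ▸ h)⟩

end WaitOrMove

open WaitOrMove in
theorem waitOrMove_isStructural : waitOrMove.IsStructural := by
  intro G G' H H' r i c
  have hk : ∀ k : ℕ, (∀ j, (chosen G' H' j).card = k) ↔ ∀ j, (chosen G H j).card = k := by
    intro k
    simp only [chosen_renaming r, Finset.card_map]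
    exact r.β.forall_congr_right (q := fun j => (chosen G H j).card = k)
  have hc : Fintype.card (G'.Choice i) = Fintype.card (G.Choice (r.β i)) :=
    Fintype.card_congr (r.toEquiv i).symm
  have h1 : r.toEquiv i c ∈ chosen G' H' i ↔ c ∈ chosen G H (r.β i) := by
    rw [chosen_renaming r]; simp
  have h2 : r.toEquiv i c ∈ coordinating G' H' i ↔ c ∈ coordinating G H (r.β i) := by
    rw [coordinating_renaming r]; simp
  have h3 : (coordinating G' H' i).card = (coordinating G H (r.β i)).card := by
    rw [coordinating_renaming r, Finset.card_map]
  change prob G H (r.β i) c = prob G' H' i (r.toEquiv i c)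
  unfold prob
  simp only [hk, h3, hc]
  classical
  exact if_congr Iff.rfl
    (congrArg₂ _ (if_congr h1.symm rfl rfl) (if_congr h2.symm rfl rfl))
    (if_congr Iff.rfl (if_congr h1.symm rfl rfl) rfl)

/-! ### First-step analysis of the expected coordination time. -/

namespace Protocol

variable {n : ℕ} (P : Protocol n) (G : WLCGame n)

theorem profileProb_nonneg (H : G.History) (σ : G.Profile) : 0 ≤ P.profileProb G H σ :=
  Finset.prod_nonneg fun i _ => P.prob_nonneg G H i (σ i)

theorem sum_profileProb (H : G.History) : ∑ σ, P.profileProb G H σ = 1 := by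
  classical
  simp only [profileProb]
  rw [← Fintype.prod_sum fun i c => P.prob G H i c]
  exact Finset.prod_eq_one fun i _ => P.sum_prob G H i

theorem sum_ofReal_profileProb (H : G.History) :
    ∑ σ, ENNReal.ofReal (P.profileProb G H σ) = 1 := by
  rw [← ENNReal.ofReal_sum_of_nonneg fun σ _ => P.profileProb_nonneg G H σ, sum_profileProb,
    ENNReal.ofReal_one]

theorem timeProb_nonneg (k : ℕ) (H : G.History) : 0 ≤ P.timeProb G k H := by
  induction k generalizing H with
  | zero => unfold timeProb; split_ifs <;> norm_num
  | succ k ih =>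
    unfold timeProb
    split_ifs
    · exact le_rfl
    · exact Finset.sum_nonneg fun σ _ => mul_nonneg (P.profileProb_nonneg G H σ) (ih _)

theorem timeProb_zero_of_isFinal {H : G.History} (h : G.IsFinal H) : P.timeProb G 0 H = 1 := by
  simp [timeProb, h]

theorem timeProb_succ_of_isFinal {H : G.History} (h : G.IsFinal H) (k : ℕ) :
    P.timeProb G (k + 1) H = 0 := by
  simp [timeProb, h]

theorem timeProb_zero_of_not_isFinal {H : G.History} (h : ¬ G.IsFinal H) :
    P.timeProb G 0 H = 0 := by
  simp [timeProb, h]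

theorem timeProb_succ_of_not_isFinal {H : G.History} (h : ¬ G.IsFinal H) (k : ℕ) :
    P.timeProb G (k + 1) H = ∑ σ, P.profileProb G H σ * P.timeProb G k (σ :: H) := by
  simp [timeProb, h]

theorem ofReal_timeProb_succ {H : G.History} (h : ¬ G.IsFinal H) (k : ℕ) :
    ENNReal.ofReal (P.timeProb G (k + 1) H) =
      ∑ σ, ENNReal.ofReal (P.profileProb G H σ) * ENNReal.ofReal (P.timeProb G k (σ :: H)) := by
  rw [P.timeProb_succ_of_not_isFinal G h, ENNReal.ofReal_sum_of_nonneg fun σ _ =>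
    mul_nonneg (P.profileProb_nonneg G H σ) (P.timeProb_nonneg G k _)]
  exact Finset.sum_congr rfl fun σ _ => ENNReal.ofReal_mul (P.profileProb_nonneg G H σ)

theorem sum_range_timeProb_le_one (N : ℕ) (H : G.History) :
    ∑ k ∈ Finset.range N, P.timeProb G k H ≤ 1 := by
  induction N generalizing H with
  | zero => simp
  | succ N ih =>
    rw [Finset.sum_range_succ']
    by_cases h : G.IsFinal H
    · simp [timeProb_succ_of_isFinal, timeProb_zero_of_isFinal, h]
    · simp only [P.timeProb_succ_of_not_isFinal G h, P.timeProb_zero_of_not_isFinal G h, add_zero]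
      rw [Finset.sum_comm]
      simp only [← Finset.mul_sum]
      calc _ ≤ ∑ σ, P.profileProb G H σ * 1 := Finset.sum_le_sum fun σ _ =>
            mul_le_mul_of_nonneg_left (ih _) (P.profileProb_nonneg G H σ)
        _ = 1 := by simp [sum_profileProb]

theorem tsum_timeProb_le_one (H : G.History) :
    ∑' k, ENNReal.ofReal (P.timeProb G k H) ≤ 1 := by
  rw [ENNReal.tsum_eq_iSup_nat]
  refine iSup_le fun N => ?_
  rw [← ENNReal.ofReal_sum_of_nonneg fun k _ => P.timeProb_nonneg G k H]
  exact ENNReal.ofReal_le_one.2 (P.sum_range_timeProb_le_one G N H)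

theorem ect_of_isFinal {H : G.History} (h : G.IsFinal H) : P.ect G H = 0 := by
  have h1 : ∑' k, ENNReal.ofReal (P.timeProb G k H) = 1 := by
    rw [tsum_eq_single 0]
    · simp [timeProb_zero_of_isFinal, h]
    · rintro (_ | k) hk
      · exact absurd rfl hk
      · simp [timeProb_succ_of_isFinal, h]
  have h2 : ∑' k : ℕ, (k : ℝ≥0∞) * ENNReal.ofReal (P.timeProb G k H) = 0 := by
    rw [ENNReal.tsum_eq_zero]
    rintro (_ | k)
    · simp
    · simp [timeProb_succ_of_isFinal, h]
  simp [ect, h1, h2]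

/-- If mass is missing, both sides are infinite. This lets the one-round cost be charged to the full
mass 1 instead of the mass of terminating plays. -/
theorem add_top_mul_one_sub {s : ℝ≥0∞} (hs : s ≤ 1) : s + ∞ * (1 - s) = 1 + ∞ * (1 - s) := by
  rcases hs.eq_or_lt with rfl | hs
  · rfl
  · rw [ENNReal.top_mul (tsub_pos_of_lt hs).ne', add_top, add_top]

/-- The expected coordination time from a non-final stage, by conditioning on the next round. -/
theorem ect_of_not_isFinal {H : G.History} (h : ¬ G.IsFinal H) :
    P.ect G H = 1 + ∑ σ, ENNReal.ofReal (P.profileProb G H σ) * P.ect G (σ :: H) := by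
  set p : G.Profile → ℝ≥0∞ := fun σ => ENNReal.ofReal (P.profileProb G H σ) with hp
  set S : G.Profile → ℝ≥0∞ := fun σ => ∑' k, ENNReal.ofReal (P.timeProb G k (σ :: H)) with hS
  set E : G.Profile → ℝ≥0∞ :=
    fun σ => ∑' k : ℕ, (k : ℝ≥0∞) * ENNReal.ofReal (P.timeProb G k (σ :: H)) with hE
  have hp1 : ∑ σ, p σ = 1 := P.sum_ofReal_profileProb G H
  have hS1 : ∀ σ, S σ ≤ 1 := fun σ => P.tsum_timeProb_le_one G _
  have hmass : ∑' k, ENNReal.ofReal (P.timeProb G k H) = ∑ σ, p σ * S σ := by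
    rw [tsum_eq_zero_add' ENNReal.summable, P.timeProb_zero_of_not_isFinal G h,
      ENNReal.ofReal_zero, zero_add]
    simp only [P.ofReal_timeProb_succ G h]
    rw [Summable.tsum_finsetSum fun _ _ => ENNReal.summable]
    simp only [ENNReal.tsum_mul_left, hp, hS]
  have hmean : ∑' k : ℕ, (k : ℝ≥0∞) * ENNReal.ofReal (P.timeProb G k H) =
      ∑ σ, p σ * (E σ + S σ) := by
    rw [tsum_eq_zero_add' ENNReal.summable, Nat.cast_zero, zero_mul, zero_add]
    simp only [P.ofReal_timeProb_succ G h, Finset.mul_sum]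
    rw [Summable.tsum_finsetSum fun _ _ => ENNReal.summable]
    refine Finset.sum_congr rfl fun σ _ => ?_
    simp only [hE, hS]
    rw [← ENNReal.tsum_add, ← ENNReal.tsum_mul_left]
    refine tsum_congr fun k => ?_
    push_cast
    ring
  have hsub : 1 - ∑ σ, p σ * S σ = ∑ σ, p σ * (1 - S σ) := by
    have hle : ∑ σ, p σ * S σ ≤ 1 := hmass ▸ P.tsum_timeProb_le_one G H
    refine ENNReal.sub_eq_of_eq_add (ne_top_of_le_ne_top ENNReal.one_ne_top hle) ?_
    rw [← Finset.sum_add_distrib]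
    refine hp1.symm.trans (Finset.sum_congr rfl fun σ _ => ?_)
    rw [← mul_add, tsub_add_cancel_of_le (hS1 σ), mul_one]
  rw [ect, hmass, hmean, hsub, Finset.mul_sum, ← Finset.sum_add_distrib]
  conv_rhs => rw [← hp1, ← Finset.sum_add_distrib]
  refine Finset.sum_congr rfl fun σ _ => ?_
  change p σ * (E σ + S σ) + ∞ * (p σ * (1 - S σ)) = p σ + p σ * (E σ + ∞ * (1 - S σ))
  calc p σ * (E σ + S σ) + ∞ * (p σ * (1 - S σ))
      = p σ * E σ + p σ * (S σ + ∞ * (1 - S σ)) := by ring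
    _ = p σ * E σ + p σ * (1 + ∞ * (1 - S σ)) := by rw [add_top_mul_one_sub (hS1 σ)]
    _ = _ := by ring

/-- A bounded function on the stages that vanishes on final stages and grows in expectation by at
most one in each round is a lower bound for the expected coordination time. -/
theorem ofReal_le_ect (L : G.History → ℝ) (hL0 : ∀ H, 0 ≤ L H) (hL2 : ∀ H, L H ≤ 2)
    (hfin : ∀ H, G.IsFinal H → L H = 0)
    (hstep : ∀ H, ¬ G.IsFinal H → L H ≤ 1 + ∑ σ, P.profileProb G H σ * L (σ :: H))
    (H : G.History) : ENNReal.ofReal (L H) ≤ P.ect G H := by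
  -- The factor `1 - 2^(-N)` starts the induction at 0, so termination of the play need not be
  -- assumed. Passing to `N + 1` adds `2^(-(N+1)) * L H`, which is at most the `2^(-N)` to spare
  -- because `L ≤ 2`.
  have key : ∀ (N : ℕ) (H : G.History),
      ENNReal.ofReal ((1 - (1 / 2) ^ N) * L H) ≤ P.ect G H := by
    intro N
    induction N with
    | zero => simp
    | succ N ih =>
      intro H
      by_cases h : G.IsFinal H
      · simp [hfin H h]
      have hc : (0 : ℝ) ≤ 1 - (1 / 2) ^ N := by
        rw [sub_nonneg]
        exact pow_le_one₀ (by norm_num) (by norm_num)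
      calc ENNReal.ofReal ((1 - (1 / 2) ^ (N + 1)) * L H)
          ≤ ENNReal.ofReal (1 + ∑ σ, P.profileProb G H σ *
              ((1 - (1 / 2) ^ N) * L (σ :: H))) := by
            apply ENNReal.ofReal_le_ofReal
            have h1 : ∑ σ, P.profileProb G H σ * ((1 - (1 / 2) ^ N) * L (σ :: H)) =
                (1 - (1 / 2) ^ N) * ∑ σ, P.profileProb G H σ * L (σ :: H) := by
              rw [Finset.mul_sum]
              exact Finset.sum_congr rfl fun σ _ => by ring
            rw [h1]
            have h2 := mul_le_mul_of_nonneg_left (hstep H h) hc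
            have h3 : (0 : ℝ) ≤ (1 / 2) ^ N := by positivity
            have h4 := mul_le_mul_of_nonneg_left (hL2 H) h3
            rw [pow_succ]
            linarith
        _ = 1 + ∑ σ, ENNReal.ofReal (P.profileProb G H σ) *
              ENNReal.ofReal ((1 - (1 / 2) ^ N) * L (σ :: H)) := by
            have hnn : ∀ σ, 0 ≤ P.profileProb G H σ * ((1 - (1 / 2) ^ N) * L (σ :: H)) :=
              fun σ => mul_nonneg (P.profileProb_nonneg G H σ) (mul_nonneg hc (hL0 _))
            rw [ENNReal.ofReal_add zero_le_one (Finset.sum_nonneg fun σ _ => hnn σ),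
              ENNReal.ofReal_one, ENNReal.ofReal_sum_of_nonneg fun σ _ => hnn σ]
            congr 1
            exact Finset.sum_congr rfl fun σ _ =>
              ENNReal.ofReal_mul (P.profileProb_nonneg G H σ)
        _ ≤ _ := by
            rw [P.ect_of_not_isFinal G h]
            gcongr with σ
            exact ih _
  have hlim : Filter.Tendsto (fun N : ℕ => ENNReal.ofReal ((1 - (1 / 2) ^ N) * L H))
      Filter.atTop (nhds (ENNReal.ofReal (L H))) := by
    refine (ENNReal.continuous_ofReal.tendsto _).comp ?_
    have h0 : Filter.Tendsto (fun N : ℕ => ((1 : ℝ) / 2) ^ N) Filter.atTop (nhds 0) :=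
      tendsto_pow_atTop_nhds_zero_of_lt_one (by norm_num) (by norm_num)
    simpa using (h0.const_sub 1).mul_const (L H)
  exact le_of_tendsto' hlim fun N => key N H

/-- Looking one round ahead can improve on `L H` itself. This matters at the empty history, where
the potential is not sharp. -/
theorem le_ect_of_sum (L : G.History → ℝ) (hL0 : ∀ H, 0 ≤ L H)
    (hle : ∀ H, ENNReal.ofReal (L H) ≤ P.ect G H) {H : G.History} (h : ¬ G.IsFinal H) :
    ENNReal.ofReal (1 + ∑ σ, P.profileProb G H σ * L (σ :: H)) ≤ P.ect G H := by
  have hnn : ∀ σ, 0 ≤ P.profileProb G H σ * L (σ :: H) :=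
    fun σ => mul_nonneg (P.profileProb_nonneg G H σ) (hL0 _)
  rw [P.ect_of_not_isFinal G h,
    ENNReal.ofReal_add zero_le_one (Finset.sum_nonneg fun σ _ => hnn σ),
    ENNReal.ofReal_one, ENNReal.ofReal_sum_of_nonneg fun σ _ => hnn σ]
  gcongr with σ
  rw [ENNReal.ofReal_mul (P.profileProb_nonneg G H σ)]
  gcongr
  exact hle _

/-- If the lower bound given by `L` after one more round is attained at a stage, then it is
attained at every next stage of positive probability. -/
theorem ect_cons_eq (L : G.History → ℝ) (hL0 : ∀ H, 0 ≤ L H)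
    (hle : ∀ H, ENNReal.ofReal (L H) ≤ P.ect G H) {H : G.History} (h : ¬ G.IsFinal H)
    (heq : P.ect G H ≤ ENNReal.ofReal (1 + ∑ σ, P.profileProb G H σ * L (σ :: H)))
    {σ : G.Profile} (hσ : 0 < P.profileProb G H σ) :
    P.ect G (σ :: H) = ENNReal.ofReal (L (σ :: H)) := by
  have hnn : ∀ σ, 0 ≤ P.profileProb G H σ * L (σ :: H) :=
    fun σ => mul_nonneg (P.profileProb_nonneg G H σ) (hL0 _)
  rw [P.ect_of_not_isFinal G h,
    ENNReal.ofReal_add zero_le_one (Finset.sum_nonneg fun σ _ => hnn σ),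
    ENNReal.ofReal_one, ENNReal.ofReal_sum_of_nonneg fun σ _ => hnn σ,
    ENNReal.add_le_add_iff_left ENNReal.one_ne_top] at heq
  simp only [ENNReal.ofReal_mul (P.profileProb_nonneg G H _)] at heq
  refine le_antisymm ?_ (hle _)
  by_contra! hlt
  have hlt' := (ENNReal.mul_lt_mul_iff_right (ENNReal.ofReal_pos.2 hσ).ne'
    ENNReal.ofReal_ne_top).2 hlt
  refine heq.not_gt ?_
  classical
  rw [← Finset.add_sum_erase _ _ (Finset.mem_univ σ),
    ← Finset.add_sum_erase _ _ (Finset.mem_univ σ)]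
  -- A strict gap in one term survives the addition only because the remaining lower bounds have a
  -- finite sum.
  refine ENNReal.add_lt_add_of_lt_of_le ?_ hlt' (Finset.sum_le_sum fun ρ _ => ?_)
  · exact ENNReal.sum_ne_top.2 fun ρ _ => ENNReal.mul_ne_top ENNReal.ofReal_ne_top
      ENNReal.ofReal_ne_top
  · gcongr
    exact hle _

end Protocol

/-! ### Rows and symmetric stages of the choice matching game. -/

namespace ChoiceMatching

open WLCGame

variable {m : ℕ} {hm : 0 < m}

/-- The profile of the choice matching game in which the players pick the rows `c` and `d`. -/
def pair (hm : 0 < m) (c d : Fin m) : (choiceMatching 2 m hm).Profile :=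
  Fin.cons (α := fun _ => Fin m) c fun _ => d

/-- The row that player `i` picks in a profile. -/
def row (σ : (choiceMatching 2 m hm).Profile) (i : Fin 2) : Fin m := σ i

@[simp] theorem row_pair_zero (c d : Fin m) : row (pair hm c d) 0 = c := rfl

@[simp] theorem row_pair_one (c d : Fin m) : row (pair hm c d) 1 = d := rfl

theorem profile_ext {σ ρ : (choiceMatching 2 m hm).Profile} (h0 : row σ 0 = row ρ 0)
    (h1 : row σ 1 = row ρ 1) : σ = ρ := by
  funext i
  match i with
  | 0 => exact h0
  | 1 => exact h1

theorem pair_row (σ : (choiceMatching 2 m hm).Profile) : pair hm (row σ 0) (row σ 1) = σ :=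
  profile_ext rfl rfl

theorem mem_win {σ : (choiceMatching 2 m hm).Profile} :
    σ ∈ (choiceMatching 2 m hm).Win ↔ row σ 0 = row σ 1 := by
  constructor
  · rintro ⟨a, ha⟩
    exact (ha 0).trans (ha 1).symm
  · intro h
    refine ⟨row σ 0, fun i => ?_⟩
    match i with
    | 0 => rfl
    | 1 => exact h.symm

theorem sum_profile {M : Type*} [AddCommMonoid M] (f : (choiceMatching 2 m hm).Profile → M) :
    ∑ σ, f σ = ∑ c, ∑ d, f (pair hm c d) := by
  rw [← Fintype.sum_prod_type' fun c d => f (pair hm c d)]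
  refine Fintype.sum_equiv ⟨fun σ => (row σ 0, row σ 1), fun x => pair hm x.1 x.2, pair_row,
    fun _ => rfl⟩ _ _ fun σ => ?_
  exact congrArg f (pair_row σ).symm

/-- The probability that player `i` picks the row `c`. -/
def rowProb (P : Protocol 2) (H : (choiceMatching 2 m hm).History) (i : Fin 2) (c : Fin m) : ℝ :=
  P.prob (choiceMatching 2 m hm) H i c

variable (P : Protocol 2) (H : (choiceMatching 2 m hm).History)

theorem rowProb_nonneg (i : Fin 2) (c : Fin m) : 0 ≤ rowProb P H i c := P.prob_nonneg _ _ _ _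

theorem sum_rowProb (i : Fin 2) : ∑ c, rowProb P H i c = 1 :=
  P.sum_prob (choiceMatching 2 m hm) H i

theorem profileProb_eq (σ : (choiceMatching 2 m hm).Profile) :
    P.profileProb (choiceMatching 2 m hm) H σ =
      rowProb P H 0 (row σ 0) * rowProb P H 1 (row σ 1) :=
  Fin.prod_univ_two _

theorem not_isFinal_iff :
    ¬ (choiceMatching 2 m hm).IsFinal H ↔ ∀ σ ∈ H, row σ 0 ≠ row σ 1 := by
  simp only [IsFinal, mem_win, not_exists, not_and, ne_eq]

/-- The rows that have been selected by some player in the history. -/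
def touched : Finset (Fin m) := {x | ∃ σ ∈ H, row σ 0 = x ∨ row σ 1 = x}

variable {H}

theorem mem_touched {x : Fin m} : x ∈ touched H ↔ ∃ σ ∈ H, row σ 0 = x ∨ row σ 1 = x := by
  simp [touched]

theorem touched_cons (σ : (choiceMatching 2 m hm).Profile) :
    touched (σ :: H) = insert (row σ 0) (insert (row σ 1) (touched H)) := by
  ext x
  simp only [mem_touched, List.mem_cons, exists_eq_or_imp, Finset.mem_insert, eq_comm (b := x),
    or_assoc]

/-- The permutation `τ` of the rows, together with the exchange of the players, is a symmetry of
the stage, and it moves exactly the rows selected so far. -/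
structure IsSymmetry (H : (choiceMatching 2 m hm).History) (τ : Equiv.Perm (Fin m)) : Prop where
  involutive : ∀ x, τ (τ x) = x
  moves : ∀ x, τ x ≠ x ↔ x ∈ touched H
  row_one : ∀ σ ∈ H, τ (row σ 0) = row σ 1

namespace IsSymmetry

variable {τ : Equiv.Perm (Fin m)}

theorem row_zero (h : IsSymmetry H τ) {σ : (choiceMatching 2 m hm).Profile} (hσ : σ ∈ H) :
    τ (row σ 1) = row σ 0 := by
  rw [← h.row_one σ hσ, h.involutive]

theorem not_isFinal (h : IsSymmetry H τ) : ¬ (choiceMatching 2 m hm).IsFinal H := by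
  rw [not_isFinal_iff]
  intro σ hσ
  rw [← h.row_one σ hσ]
  exact ((h.moves _).2 (mem_touched.2 ⟨σ, hσ, Or.inl rfl⟩)).symm

theorem apply_mem_touched (h : IsSymmetry H τ) {x : Fin m} : τ x ∈ touched H ↔ x ∈ touched H := by
  rw [← h.moves, ← h.moves, h.involutive, ne_comm]

theorem apply_of_not_mem (h : IsSymmetry H τ) {x : Fin m} (hx : x ∉ touched H) : τ x = x := by
  by_contra hne
  exact hx ((h.moves x).1 hne)

/-- A mirror pair of touched rows adds no new row and respects the old involution. -/
theorem cons_touched (h : IsSymmetry H τ) {σ : (choiceMatching 2 m hm).Profile}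
    (h0 : row σ 0 ∈ touched H) (h1 : τ (row σ 0) = row σ 1) :
    IsSymmetry (σ :: H) τ ∧ touched (σ :: H) = touched H := by
  have ht : touched (σ :: H) = touched H := by
    rw [touched_cons, ← h1, Finset.insert_eq_of_mem (h.apply_mem_touched.2 h0),
      Finset.insert_eq_of_mem h0]
  refine ⟨⟨h.involutive, fun x => ht ▸ h.moves x, ?_⟩, ht⟩
  intro ρ hρ
  rcases List.mem_cons.1 hρ with rfl | hρ
  · exact h1
  · exact h.row_one ρ hρ

/-- The old involution fixes both new rows, so it can be extended by the transposition exchanging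
them. -/
theorem cons_untouched (h : IsSymmetry H τ) {σ : (choiceMatching 2 m hm).Profile}
    (h0 : row σ 0 ∉ touched H) (h1 : row σ 1 ∉ touched H) (hne : row σ 0 ≠ row σ 1) :
    IsSymmetry (σ :: H) (τ * Equiv.swap (row σ 0) (row σ 1)) ∧
      (touched (σ :: H))ᶜ.card = (touched H)ᶜ.card - 2 := by
  have e0 := h.apply_of_not_mem h0
  have e1 := h.apply_of_not_mem h1
  have hfix : ∀ x, x ≠ row σ 0 → x ≠ row σ 1 →
      (τ * Equiv.swap (row σ 0) (row σ 1)) x = τ x := by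
    intro x hx0 hx1
    rw [Equiv.Perm.mul_apply, Equiv.swap_apply_of_ne_of_ne hx0 hx1]
  have hs0 : (τ * Equiv.swap (row σ 0) (row σ 1)) (row σ 0) = row σ 1 := by
    rw [Equiv.Perm.mul_apply, Equiv.swap_apply_left, e1]
  have hs1 : (τ * Equiv.swap (row σ 0) (row σ 1)) (row σ 1) = row σ 0 := by
    rw [Equiv.Perm.mul_apply, Equiv.swap_apply_right, e0]
  refine ⟨⟨fun x => ?_, fun x => ?_, fun ρ hρ => ?_⟩, ?_⟩
  · by_cases hx0 : x = row σ 0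
    · rw [hx0, hs0, hs1]
    by_cases hx1 : x = row σ 1
    · rw [hx1, hs1, hs0]
    rw [hfix x hx0 hx1, hfix, h.involutive]
    · rwa [Ne, ← e0, τ.injective.eq_iff]
    · rwa [Ne, ← e1, τ.injective.eq_iff]
  · rw [touched_cons, Finset.mem_insert, Finset.mem_insert]
    by_cases hx0 : x = row σ 0
    · rw [hx0, hs0]; simp [hne.symm]
    by_cases hx1 : x = row σ 1
    · rw [hx1, hs1]; simp [hne]
    rw [hfix x hx0 hx1, h.moves]
    simp [hx0, hx1]
  · rcases List.mem_cons.1 hρ with rfl | hρ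
    · exact hs0
    · have ht0 : row ρ 0 ∈ touched H := mem_touched.2 ⟨ρ, hρ, Or.inl rfl⟩
      rw [hfix _ (fun e => h0 (e ▸ ht0)) (fun e => h1 (e ▸ ht0))]
      exact h.row_one ρ hρ
  · have h01 : row σ 0 ∉ insert (row σ 1) (touched H) := by simp [hne, h0]
    rw [Finset.card_compl, Finset.card_compl, touched_cons, Finset.card_insert_of_notMem h01,
      Finset.card_insert_of_notMem h1]
    omega

end IsSymmetry

variable {P}

/-- A structural protocol treats the rows that were not selected so far alike. -/
theorem rowProb_eq_of_not_mem_touched (hP : P.IsStructural) (i : Fin 2) {x y : Fin m}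
    (hx : x ∉ touched H) (hy : y ∉ touched H) : rowProb P H i x = rowProb P H i y := by
  have hfix : ∀ z ∈ touched H, Equiv.swap x y z = z := fun z hz =>
    Equiv.swap_apply_of_ne_of_ne (fun e => hx (e ▸ hz)) fun e => hy (e ▸ hz)
  have := hP (choiceMatching 2 m hm) (choiceMatching 2 m hm) H H
    { β := 1
      toEquiv := fun _ => (Equiv.swap x y : Equiv.Perm (Fin m))
      win_iff := fun σ => by
        rw [mem_win, mem_win]
        exact (Equiv.swap x y).injective.eq_iff.symm
      history_eq := by
        refine ((List.map_congr_left fun σ hσ => ?_).trans (List.map_id H)).symm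
        exact profile_ext (hfix _ (mem_touched.2 ⟨σ, hσ, Or.inl rfl⟩))
          (hfix _ (mem_touched.2 ⟨σ, hσ, Or.inr rfl⟩)) } i x
  refine this.trans ?_
  exact congrArg (rowProb P H i) (Equiv.swap_apply_left x y)

/-- Structurality applied to the renaming of the stage onto itself that exchanges the players and
permutes the rows by `τ`. -/
theorem IsSymmetry.rowProb_one {τ : Equiv.Perm (Fin m)} (h : IsSymmetry H τ)
    (hP : P.IsStructural) (x : Fin m) : rowProb P H 1 x = rowProb P H 0 (τ x) :=
  hP (choiceMatching 2 m hm) (choiceMatching 2 m hm) H H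
    { β := Equiv.swap 0 1
      toEquiv := fun _ => τ
      win_iff := fun σ => by
        rw [mem_win, mem_win]
        exact eq_comm.trans τ.injective.eq_iff.symm
      history_eq := by
        refine ((List.map_congr_left fun σ hσ => ?_).trans (List.map_id H)).symm
        exact profile_ext (h.row_zero hσ) (h.row_one σ hσ) } 0 x

end ChoiceMatching

/-! ### The potential and its growth in one round. -/

namespace ChoiceMatching

open WLCGame

variable {m : ℕ} {hm : 0 < m}

/-- A lower bound for the expected coordination time from a symmetric stage in which `u` rows have
not been selected so far. -/
noncomputable def symmetricBound (u : ℕ) : ℝ := if u = 1 then 1 else if u = 3 then 5 / 3 else 2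

theorem one_le_symmetricBound (u : ℕ) : 1 ≤ symmetricBound u := by
  unfold symmetricBound; split_ifs <;> norm_num

theorem symmetricBound_le_two (u : ℕ) : symmetricBound u ≤ 2 := by
  unfold symmetricBound; split_ifs <;> norm_num

theorem symmetricBound_of_four_le {u : ℕ} (hu : 4 ≤ u) : symmetricBound u = 2 := by
  unfold symmetricBound; rw [if_neg (by omega), if_neg (by omega)]

open Classical in
/-- A lower bound for the expected coordination time of structural protocols. -/
noncomputable def lowerBound (H : (choiceMatching 2 m hm).History) : ℝ :=
  if (choiceMatching 2 m hm).IsFinal H then 0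
  else if ∃ τ, IsSymmetry H τ then symmetricBound (touched H)ᶜ.card else 1

variable {H : (choiceMatching 2 m hm).History} {τ : Equiv.Perm (Fin m)}

theorem lowerBound_of_isFinal (h : (choiceMatching 2 m hm).IsFinal H) : lowerBound H = 0 :=
  if_pos h

theorem IsSymmetry.lowerBound_eq (h : IsSymmetry H τ) :
    lowerBound H = symmetricBound (touched H)ᶜ.card := by
  rw [lowerBound, if_neg h.not_isFinal, if_pos ⟨τ, h⟩]

theorem lowerBound_of_forall_not (h : ¬ (choiceMatching 2 m hm).IsFinal H)
    (hs : ¬ ∃ τ, IsSymmetry H τ) : lowerBound H = 1 := by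
  rw [lowerBound, if_neg h, if_neg hs]

theorem one_le_lowerBound (h : ¬ (choiceMatching 2 m hm).IsFinal H) : 1 ≤ lowerBound H := by
  rw [lowerBound, if_neg h]
  split_ifs
  · exact one_le_symmetricBound _
  · exact le_rfl

theorem lowerBound_nonneg (H : (choiceMatching 2 m hm).History) : 0 ≤ lowerBound H := by
  by_cases h : (choiceMatching 2 m hm).IsFinal H
  · rw [lowerBound_of_isFinal h]
  · exact zero_le_one.trans (one_le_lowerBound h)

theorem lowerBound_le_two (H : (choiceMatching 2 m hm).History) : lowerBound H ≤ 2 := by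
  unfold lowerBound
  split_ifs
  · norm_num
  · exact symmetricBound_le_two _
  · norm_num

theorem not_isFinal_cons {σ : (choiceMatching 2 m hm).Profile}
    (h : ¬ (choiceMatching 2 m hm).IsFinal H) (hσ : row σ 0 ≠ row σ 1) :
    ¬ (choiceMatching 2 m hm).IsFinal (σ :: H) := by
  rw [not_isFinal_iff] at h ⊢
  intro ρ hρ
  rcases List.mem_cons.1 hρ with rfl | hρ
  · exact hσ
  · exact h ρ hρ

theorem isFinal_cons {σ : (choiceMatching 2 m hm).Profile} (hσ : row σ 0 = row σ 1) :
    (choiceMatching 2 m hm).IsFinal (σ :: H) :=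
  ⟨σ, List.mem_cons_self, mem_win.2 hσ⟩

/-- The round following a symmetric stage either coordinates, or preserves the symmetry, or
breaks it. -/
theorem IsSymmetry.le_lowerBound_cons (h : IsSymmetry H τ) (c d : Fin m) :
    -- Player 1's row is written `τ d`, so that both `c` and `d` are distributed as player 0's row.
    -- Coordination is then `d = τ c`, and a touched mirror pair is `d = c`.
    1 - (if d = τ c then 1 else 0) +
      (symmetricBound (touched H)ᶜ.card - 1) *
        (if d = c then (if c ∈ touched H then 1 else 0) else 0) +
      (symmetricBound ((touched H)ᶜ.card - 2) - 1) *
        ((if c ∈ touched H then 0 else 1) * (if d ∈ touched H then 0 else 1) -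
          (if d = c then (if c ∈ touched H then 0 else 1) else 0)) ≤
      lowerBound (pair hm c (τ d) :: H) := by
  by_cases hc : c ∈ touched H
  · have hcc : τ c ≠ c := (h.moves c).2 hc
    by_cases h1 : d = τ c
    · subst h1
      rw [lowerBound_of_isFinal (isFinal_cons (σ := pair hm c _) (h.involutive c).symm)]
      simp [hc, hcc]
    · have hne : c ≠ τ d := fun e => h1 (by rw [e, h.involutive])
      by_cases h2 : d = c
      · subst h2
        obtain ⟨h3, h4⟩ := h.cons_touched (σ := pair hm d (τ d)) hc rfl
        rw [h3.lowerBound_eq, h4]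
        simp [hc, hcc.symm]
      · have := one_le_lowerBound (not_isFinal_cons (σ := pair hm c (τ d)) h.not_isFinal hne)
        simpa [hc, h1, h2] using this
  · have hcc : τ c = c := h.apply_of_not_mem hc
    by_cases h1 : d = c
    · subst h1
      rw [lowerBound_of_isFinal (isFinal_cons (σ := pair hm d _) hcc.symm)]
      simp [hc, hcc]
    · have hne : c ≠ τ d := fun e => h1 (by rw [← hcc, e, h.involutive])
      by_cases hd : d ∈ touched H
      · have := one_le_lowerBound (not_isFinal_cons (σ := pair hm c (τ d)) h.not_isFinal hne)
        simpa [hc, hcc, h1, hd] using this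
      · have hdd : τ d = d := h.apply_of_not_mem hd
        obtain ⟨h3, h4⟩ := h.cons_untouched (σ := pair hm c (τ d)) hc
          (by rw [row_pair_one, hdd]; exact hd) hne
        rw [h3.lowerBound_eq, h4]
        simp [hc, hcc, h1, hd]

/-- The quadratic inequality behind the growth of `symmetricBound`: `r` is the probability of the
rows not selected so far, and `q`, `s` are the sums of the squares of the probabilities of the
other rows and of these rows. -/
theorem symmetricBound_add_le {u : ℕ} {q r s : ℝ} (hr0 : 0 ≤ r) (hr1 : r ≤ 1)
    (hq : q ≤ (1 - r) ^ 2) (hs0 : 0 ≤ s) (hs : u * s = r ^ 2) (hu : u = 0 → s = 0) :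
    symmetricBound u + (if 4 ≤ u then r ^ 2 / 3 else 0) ≤
      2 - q - s + (symmetricBound u - 1) * q + (symmetricBound (u - 2) - 1) * (r ^ 2 - s) := by
  -- Here both bounds are 2 and the right side is `2 + r^2 - 2s` with `s ≤ r^2/6`.
  by_cases h6 : 6 ≤ u
  · have : (6 : ℝ) * s ≤ u * s := mul_le_mul_of_nonneg_right (by exact_mod_cast h6) hs0
    rw [symmetricBound_of_four_le (by omega), symmetricBound_of_four_le (by omega),
      if_pos (by omega)]
    nlinarith
  · have hr : 0 ≤ r * (1 - r) := mul_nonneg hr0 (sub_nonneg.2 hr1)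
    rw [← hs]
    -- The slack `r^2/3` is exact at `u = 5`, where the successor bound is `5/3`. For `u = 1` and `u
    -- = 3`, `q ≤ (1 - r)^2` is what is needed. For `u ≤ 1` the truncated `u - 2` is harmless, as
    -- then `r^2 = s`.
    interval_cases u <;> norm_num [symmetricBound] at hs hu ⊢ <;> nlinarith

/-- Averages the pointwise bound of `IsSymmetry.le_lowerBound_cons` over two independent rows with
law `x`; the diagonal terms become sums of squares. -/
theorem sum_sum_bound (x : Fin m → ℝ) (hx : ∑ c, x c = 1) (T : Finset (Fin m))
    (τ : Equiv.Perm (Fin m)) (a b : ℝ) :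
    ∑ c, ∑ d, x c * x d * (1 - (if d = τ c then 1 else 0) +
      a * (if d = c then (if c ∈ T then 1 else 0) else 0) +
      b * ((if c ∈ T then 0 else 1) * (if d ∈ T then 0 else 1) -
          (if d = c then (if c ∈ T then 0 else 1) else 0))) =
      1 - ∑ c, x c * x (τ c) + a * ∑ c ∈ T, x c ^ 2 +
        b * ((∑ c ∈ Tᶜ, x c) ^ 2 - ∑ c ∈ Tᶜ, x c ^ 2) := by
  have e1 : ∑ c ∈ T, x c ^ 2 = ∑ c, if c ∈ T then x c ^ 2 else 0 := by simp
  have e2 : ∀ f : Fin m → ℝ, ∑ c ∈ Tᶜ, f c = ∑ c, if c ∈ T then 0 else f c := by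
    intro f
    rw [← Finset.sum_add_sum_compl T fun c => if c ∈ T then 0 else f c]
    rw [Finset.sum_congr rfl fun c hc => if_pos hc, Finset.sum_const_zero, zero_add]
    exact Finset.sum_congr rfl fun c hc => (if_neg (Finset.mem_compl.1 hc)).symm
  have e3 : (1 : ℝ) = ∑ c, ∑ d, x c * x d := by
    rw [← Finset.sum_mul_sum, hx, one_mul]
  rw [e1, e2, e2, sq (∑ c, _), Finset.sum_mul_sum]
  conv_rhs => rw [e3]
  simp only [← Finset.sum_sub_distrib, Finset.mul_sum, ← Finset.sum_add_distrib]
  refine Finset.sum_congr rfl fun c _ => ?_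
  have h1 : x c * x (τ c) = ∑ d, if d = τ c then x c * x d else 0 := by simp
  have h2 : ∀ y : ℝ, y = ∑ d, if d = c then y else 0 := by simp
  rw [h1, h2 (a * _), h2 (if c ∈ T then 0 else x c ^ 2)]
  simp only [← Finset.sum_sub_distrib, Finset.mul_sum, ← Finset.sum_add_distrib]
  refine Finset.sum_congr rfl fun d _ => ?_
  by_cases hd : d = c
  · subst hd; split_ifs <;> ring
  · split_ifs <;> ring

variable {P : Protocol 2}

/-- One round from a symmetric stage, with the loss incurred by a player who distinguishes his two
choices in a pair of rows exchanged by the symmetry, or who selects a new row. -/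
theorem IsSymmetry.lowerBound_add_le (h : IsSymmetry H τ) (hP : P.IsStructural) :
    lowerBound H + (∑ c ∈ touched H, (rowProb P H 0 c - rowProb P H 0 (τ c)) ^ 2) / 2 +
      (if 4 ≤ (touched H)ᶜ.card then (∑ c ∈ (touched H)ᶜ, rowProb P H 0 c) ^ 2 / 3 else 0) ≤
      1 + ∑ σ, P.profileProb (choiceMatching 2 m hm) H σ * lowerBound (σ :: H) := by
  set x := rowProb P H 0 with hx
  have hx0 : ∀ c, 0 ≤ x c := rowProb_nonneg P H 0
  have hx1 : ∑ c, x c = 1 := sum_rowProb P H 0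
  set T := touched H with hT
  set u := Tᶜ.card with hu
  have hsplit : ∑ c ∈ T, x c + ∑ c ∈ Tᶜ, x c = 1 := by rw [Finset.sum_add_sum_compl, hx1]
  have hsum : ∑ σ, P.profileProb (choiceMatching 2 m hm) H σ * lowerBound (σ :: H) =
      ∑ c, ∑ d, x c * x d * lowerBound (pair hm c (τ d) :: H) := by
    rw [sum_profile]
    refine Finset.sum_congr rfl fun c _ => ?_
    -- Reindexing player 1's row by `τ` turns the mirrored distribution back into `x`.
    refine (Fintype.sum_equiv τ _ _ fun d => ?_).symm
    rw [profileProb_eq, row_pair_zero, row_pair_one, h.rowProb_one hP, h.involutive]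
  have hle := Finset.sum_le_sum fun c (_ : c ∈ Finset.univ) =>
    Finset.sum_le_sum fun d (_ : d ∈ Finset.univ) =>
      mul_le_mul_of_nonneg_left (h.le_lowerBound_cons c d) (mul_nonneg (hx0 c) (hx0 d))
  rw [← hsum, sum_sum_bound x hx1] at hle
  have hcross : ∑ c, x c * x (τ c) = ∑ c ∈ T, x c * x (τ c) + ∑ c ∈ Tᶜ, x c ^ 2 := by
    rw [← Finset.sum_add_sum_compl T]
    congr 1
    refine Finset.sum_congr rfl fun c hc => ?_
    rw [h.apply_of_not_mem (Finset.mem_compl.1 hc), sq]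
  have hτ : ∑ c ∈ T, x (τ c) ^ 2 = ∑ c ∈ T, x c ^ 2 :=
    Finset.sum_equiv τ (fun c => h.apply_mem_touched.symm) fun c _ => rfl
  -- The coordination probability on touched rows is the sum of squares minus half of this defect,
  -- which is the origin of the first slack term.
  have hD : ∑ c ∈ T, (x c - x (τ c)) ^ 2 =
      2 * ∑ c ∈ T, x c ^ 2 - 2 * ∑ c ∈ T, x c * x (τ c) := by
    have : ∀ c, (x c - x (τ c)) ^ 2 = x c ^ 2 + x (τ c) ^ 2 - 2 * (x c * x (τ c)) :=
      fun c => by ring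
    simp only [this, Finset.sum_sub_distrib, Finset.sum_add_distrib, hτ, ← Finset.mul_sum]
    ring
  -- Equality in Cauchy-Schwarz, since `x` is constant on untouched rows.
  have hs : u * ∑ c ∈ Tᶜ, x c ^ 2 = (∑ c ∈ Tᶜ, x c) ^ 2 := by
    rcases Tᶜ.eq_empty_or_nonempty with he | ⟨e, he⟩
    · simp [he]
    · have hv : ∀ c ∈ Tᶜ, x c = x e := fun c hc =>
        rowProb_eq_of_not_mem_touched hP 0 (Finset.mem_compl.1 hc) (Finset.mem_compl.1 he)
      rw [Finset.sum_congr rfl hv, Finset.sum_congr rfl fun c hc => by rw [hv c hc]]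
      simp only [Finset.sum_const, nsmul_eq_mul, ← hu]
      ring
  have hq : ∑ c ∈ T, x c ^ 2 ≤ (1 - ∑ c ∈ Tᶜ, x c) ^ 2 := by
    rw [← hsplit, add_sub_cancel_right]
    exact Finset.sum_sq_le_sq_sum_of_nonneg fun c _ => hx0 c
  have hT0 : 0 ≤ ∑ c ∈ T, x c := Finset.sum_nonneg fun c _ => hx0 c
  have := symmetricBound_add_le (u := u) (Finset.sum_nonneg fun c _ => hx0 c) (by linarith) hq
    (Finset.sum_nonneg fun c _ => sq_nonneg _) hs
    (fun h0 => by rw [Finset.card_eq_zero.1 (hu.symm.trans h0), Finset.sum_empty])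
  rw [h.lowerBound_eq, hD]
  rw [hcross] at hle
  linarith

theorem lowerBound_le_ect (hP : P.IsStructural) (H : (choiceMatching 2 m hm).History) :
    ENNReal.ofReal (lowerBound H) ≤ P.ect (choiceMatching 2 m hm) H := by
  refine P.ofReal_le_ect _ lowerBound lowerBound_nonneg lowerBound_le_two
    (fun H h => lowerBound_of_isFinal h) (fun H h => ?_) H
  by_cases hs : ∃ τ, IsSymmetry H τ
  · obtain ⟨τ, hτ⟩ := hs
    have h1 := hτ.lowerBound_add_le hP
    have h2 : 0 ≤ ∑ c ∈ touched H, (rowProb P H 0 c - rowProb P H 0 (τ c)) ^ 2 :=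
      Finset.sum_nonneg fun c _ => sq_nonneg _
    have h3 : (0 : ℝ) ≤ if 4 ≤ (touched H)ᶜ.card then
        (∑ c ∈ (touched H)ᶜ, rowProb P H 0 c) ^ 2 / 3 else 0 := by
      split_ifs <;> positivity
    linarith
  · rw [lowerBound_of_forall_not h hs, le_add_iff_nonneg_right]
    exact Finset.sum_nonneg fun σ _ =>
      mul_nonneg (P.profileProb_nonneg _ H σ) (lowerBound_nonneg _)

end ChoiceMatching

/-! ### Histories confined to two rows, and wait-or-move on them. -/

namespace ChoiceMatching

open WLCGame

variable {m : ℕ} {hm : 0 < m} {H : (choiceMatching 2 m hm).History} {P : Protocol 2}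

/-- A non-empty history in which the players have selected the two distinct rows `a` and `b` in
each round. -/
structure IsPairHistory (H : (choiceMatching 2 m hm).History) (a b : Fin m) : Prop where
  ne_nil : H ≠ []
  ne : a ≠ b
  rows : ∀ σ ∈ H, (row σ 0 = a ∧ row σ 1 = b) ∨ (row σ 0 = b ∧ row σ 1 = a)

theorem isPairHistory_singleton {σ : (choiceMatching 2 m hm).Profile} (h : row σ 0 ≠ row σ 1) :
    IsPairHistory [σ] (row σ 0) (row σ 1) where
  ne_nil := List.cons_ne_nil _ _
  ne := h
  rows ρ hρ := by
    rw [List.mem_singleton.1 hρ]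
    exact Or.inl ⟨rfl, rfl⟩

/-- The rows that player `i` has selected in the history. -/
def chosenRows (H : (choiceMatching 2 m hm).History) (i : Fin 2) : Finset (Fin m) :=
  {c | ∃ σ ∈ H, row σ i = c}

theorem mem_chosenRows {i : Fin 2} {c : Fin m} : c ∈ chosenRows H i ↔ ∃ σ ∈ H, row σ i = c := by
  simp [chosenRows]

theorem chosen_eq (i : Fin 2) :
    WaitOrMove.chosen (choiceMatching 2 m hm) H i = chosenRows H i := by
  ext c
  exact WaitOrMove.mem_chosen.trans mem_chosenRows.symm

theorem coordinating_eq (i : Fin 2) :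
    WaitOrMove.coordinating (choiceMatching 2 m hm) H i = chosenRows H i.rev := by
  ext c
  refine WaitOrMove.mem_coordinating.trans (Iff.trans (exists_congr fun ρ =>
    and_congr_right fun _ => ⟨?_, ?_⟩) mem_chosenRows.symm)
  · rintro ⟨σ, ⟨a, ha⟩, h1, h2⟩
    exact h2.symm.trans ((ha _).trans ((ha i).symm.trans h1))
  · intro h
    exact ⟨fun _ => c, ⟨c, fun _ => rfl⟩, rfl, h.symm⟩

theorem rowProb_waitOrMove_eq (i : Fin 2) (c : Fin m) :
    rowProb waitOrMove H i c =
      if ∀ j, (chosenRows H j).card = 1 then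
        (if c ∈ chosenRows H i then 1 / 2 else 0) +
          (if c ∈ chosenRows H i.rev then 1 / (2 * ((chosenRows H i.rev).card : ℝ)) else 0)
      else if ∀ j, (chosenRows H j).card = 2 then
        (if c ∈ chosenRows H i then 1 / 2 else 0)
      else 1 / (m : ℝ) := by
  change WaitOrMove.prob (choiceMatching 2 m hm) H i c = _
  have hcard : Fintype.card ((choiceMatching 2 m hm).Choice i) = m := Fintype.card_fin m
  unfold WaitOrMove.prob
  simp only [chosen_eq, coordinating_eq, hcard]
  congr!
  · exact iff_of_eq (congrArg (c ∈ ·) (chosen_eq i))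
  · exact iff_of_eq (congrArg (c ∈ ·) (coordinating_eq i))
  · exact iff_of_eq (congrArg (c ∈ ·) (chosen_eq i))

namespace IsPairHistory

variable {a b : Fin m}

theorem touched_eq (h : IsPairHistory H a b) : touched H = {a, b} := by
  ext x
  rw [mem_touched, Finset.mem_insert, Finset.mem_singleton]
  constructor
  · rintro ⟨σ, hσ, rfl | rfl⟩ <;> rcases h.rows σ hσ with ⟨h0, h1⟩ | ⟨h0, h1⟩ <;> simp [h0, h1]
  · obtain ⟨σ, hσ⟩ := List.exists_mem_of_ne_nil H h.ne_nil
    rintro (rfl | rfl) <;> refine ⟨σ, hσ, ?_⟩ <;>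
      rcases h.rows σ hσ with ⟨h0, h1⟩ | ⟨h0, h1⟩ <;> simp [h0, h1]

theorem isSymmetry (h : IsPairHistory H a b) : IsSymmetry H (Equiv.swap a b) where
  involutive := Equiv.swap_apply_self a b
  moves x := by
    rw [h.touched_eq, Finset.mem_insert, Finset.mem_singleton, Equiv.swap_apply_ne_self_iff]
    exact and_iff_right h.ne
  row_one σ hσ := by
    rcases h.rows σ hσ with ⟨h0, h1⟩ | ⟨h0, h1⟩
    · rw [h0, h1, Equiv.swap_apply_left]
    · rw [h0, h1, Equiv.swap_apply_right]

theorem card_compl_touched (h : IsPairHistory H a b) : (touched H)ᶜ.card = m - 2 := by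
  rw [Finset.card_compl, h.touched_eq, Finset.card_pair h.ne, Fintype.card_fin]

theorem lowerBound_eq (h : IsPairHistory H a b) (hm6 : 6 ≤ m) : lowerBound H = 2 := by
  rw [h.isSymmetry.lowerBound_eq, h.card_compl_touched, symmetricBound_of_four_le (by omega)]

theorem cons (h : IsPairHistory H a b) {σ : (choiceMatching 2 m hm).Profile}
    (hne : row σ 0 ≠ row σ 1) (h0 : row σ 0 = a ∨ row σ 0 = b)
    (h1 : row σ 1 = a ∨ row σ 1 = b) : IsPairHistory (σ :: H) a b where
  ne_nil := List.cons_ne_nil _ _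
  ne := h.ne
  rows ρ hρ := by
    rcases List.mem_cons.1 hρ with rfl | hρ
    · grind
    · exact h.rows ρ hρ

theorem rowProb_waitOrMove (h : IsPairHistory H a b) (i : Fin 2) (c : Fin m) :
    rowProb waitOrMove H i c = if c = a ∨ c = b then 1 / 2 else 0 := by
  obtain ⟨σ, hσ⟩ := List.exists_mem_of_ne_nil H h.ne_nil
  have hne := h.ne
  have hr : ∀ j, (row σ j = a ∧ row σ j.rev = b) ∨ (row σ j = b ∧ row σ j.rev = a) := by
    intro j
    match j with
    | 0 => exact h.rows σ hσ
    | 1 => exact (h.rows σ hσ).symm.imp And.symm And.symm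
  rw [rowProb_waitOrMove_eq]
  -- If all rounds agree, each player waits on one of the two rows and moves to the other, with
  -- probability `1/2` each. Otherwise both profiles have occurred, and each player has selected
  -- both rows.
  by_cases hall : ∀ ρ ∈ H, ρ = σ
  · have hch : ∀ j, chosenRows H j = {row σ j} := by
      intro j
      ext d
      rw [mem_chosenRows, Finset.mem_singleton]
      exact ⟨fun ⟨ρ, hρ, e⟩ => hall ρ hρ ▸ e.symm, fun e => ⟨σ, hσ, e.symm⟩⟩
    have hcard : ∀ j, (chosenRows H j).card = 1 := fun j => by
      rw [hch, Finset.card_singleton]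
    rw [if_pos hcard, hch, hch]
    simp only [Finset.mem_singleton, Finset.card_singleton]
    rcases hr i with ⟨h0, h1⟩ | ⟨h0, h1⟩ <;> rw [h0, h1] <;> by_cases hca : c = a <;>
      by_cases hcb : c = b <;> simp_all
  · push Not at hall
    obtain ⟨ρ, hρ, hρσ⟩ := hall
    have hch : ∀ j, chosenRows H j = {a, b} := by
      intro j
      ext d
      have h1 := h.rows σ hσ
      have h2 := h.rows ρ hρ
      have h3 : ¬ (row ρ 0 = row σ 0 ∧ row ρ 1 = row σ 1) := fun e => hρσ (profile_ext e.1 e.2)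
      rw [mem_chosenRows, Finset.mem_insert, Finset.mem_singleton]
      constructor
      · rintro ⟨μ, hμ, rfl⟩
        have := h.rows μ hμ
        match j with
        | 0 => tauto
        | 1 => tauto
      · intro hd
        have hd' : row σ j = d ∨ row ρ j = d := by
          match j with
          | 0 => grind
          | 1 => grind
        exact hd'.elim (fun e => ⟨σ, hσ, e⟩) fun e => ⟨ρ, hρ, e⟩
    have hcard : ∀ j, (chosenRows H j).card = 2 := fun j => by
      rw [hch, Finset.card_pair h.ne]
    rw [if_neg fun e => by simpa [hcard 0] using e 0, if_pos hcard, hch]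
    simp only [Finset.mem_insert, Finset.mem_singleton]

theorem sum_profileProb_waitOrMove (h : IsPairHistory H a b)
    (f : (choiceMatching 2 m hm).Profile → ℝ) :
    ∑ σ, waitOrMove.profileProb (choiceMatching 2 m hm) H σ * f σ =
      (f (pair hm a a) + f (pair hm a b) + f (pair hm b a) + f (pair hm b b)) / 4 := by
  have hsum : ∀ g : Fin m → ℝ,
      ∑ c, (if c = a ∨ c = b then (1 / 2 : ℝ) else 0) * g c = (g a + g b) / 2 := by
    intro g
    have : ∀ c, (if c = a ∨ c = b then (1 / 2 : ℝ) else 0) * g c =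
        (if c = a then g c / 2 else 0) + (if c = b then g c / 2 else 0) := by
      intro c
      by_cases h0 : c = a
      · simp only [h0, true_or, if_true]
        rw [if_neg h.ne]
        ring
      · by_cases h1 : c = b
        · simp only [h1, or_true, if_true, h.ne.symm, if_false]
          ring
        · simp [h0, h1]
    simp only [this, Finset.sum_add_distrib, Finset.sum_ite_eq', Finset.mem_univ, if_true]
    ring
  rw [sum_profile]
  simp only [profileProb_eq, row_pair_zero, row_pair_one, h.rowProb_waitOrMove, mul_assoc,
    ← Finset.mul_sum, hsum]
  ring

theorem timeProb_waitOrMove (h : IsPairHistory H a b) (k : ℕ) :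
    waitOrMove.timeProb (choiceMatching 2 m hm) (k + 1) H = (1 / 2) ^ (k + 1) := by
  induction k generalizing H with
  | zero =>
    rw [Protocol.timeProb_succ_of_not_isFinal _ _ h.isSymmetry.not_isFinal,
      h.sum_profileProb_waitOrMove,
      Protocol.timeProb_zero_of_isFinal _ _ (isFinal_cons (σ := pair hm a a) rfl),
      Protocol.timeProb_zero_of_isFinal _ _ (isFinal_cons (σ := pair hm b b) rfl),
      Protocol.timeProb_zero_of_not_isFinal _ _
        (not_isFinal_cons (σ := pair hm a b) h.isSymmetry.not_isFinal h.ne),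
      Protocol.timeProb_zero_of_not_isFinal _ _
        (not_isFinal_cons (σ := pair hm b a) h.isSymmetry.not_isFinal h.ne.symm)]
    norm_num
  | succ k ih =>
    rw [Protocol.timeProb_succ_of_not_isFinal _ _ h.isSymmetry.not_isFinal,
      h.sum_profileProb_waitOrMove,
      Protocol.timeProb_succ_of_isFinal _ _ (isFinal_cons (σ := pair hm a a) rfl),
      Protocol.timeProb_succ_of_isFinal _ _ (isFinal_cons (σ := pair hm b b) rfl),
      ih (h.cons (σ := pair hm a b) h.ne (Or.inl rfl) (Or.inr rfl)),
      ih (h.cons (σ := pair hm b a) h.ne.symm (Or.inr rfl) (Or.inl rfl)), pow_succ _ (k + 1)]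
    ring

theorem ect_waitOrMove (h : IsPairHistory H a b) :
    waitOrMove.ect (choiceMatching 2 m hm) H = 2 := by
  have h0 := waitOrMove.timeProb_zero_of_not_isFinal _ h.isSymmetry.not_isFinal
  have hs1 : HasSum (fun k : ℕ => ((1 : ℝ) / 2) ^ (k + 1)) 1 := by
    simpa [pow_succ] using hasSum_geometric_two.mul_right ((1 : ℝ) / 2)
  have hs2 : HasSum (fun k : ℕ => (k : ℝ) * ((1 : ℝ) / 2) ^ k) 2 := by
    have := hasSum_coe_mul_geometric_of_norm_lt_one (r := (1 : ℝ) / 2) (by norm_num)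
    norm_num at this ⊢
    exact this
  have hmass : ∑' k, ENNReal.ofReal (waitOrMove.timeProb (choiceMatching 2 m hm) k H) = 1 := by
    rw [tsum_eq_zero_add' ENNReal.summable, h0, ENNReal.ofReal_zero, zero_add]
    simp only [h.timeProb_waitOrMove]
    rw [← ENNReal.ofReal_tsum_of_nonneg (fun k => by positivity) hs1.summable, hs1.tsum_eq,
      ENNReal.ofReal_one]
  have hmean : ∑' k : ℕ, (k : ℝ≥0∞) *
      ENNReal.ofReal (waitOrMove.timeProb (choiceMatching 2 m hm) k H) = 2 := by
    have : ∀ k : ℕ, (k : ℝ≥0∞) *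
        ENNReal.ofReal (waitOrMove.timeProb (choiceMatching 2 m hm) k H) =
        ENNReal.ofReal ((k : ℝ) * (1 / 2) ^ k) := by
      rintro (_ | k)
      · simp
      · rw [h.timeProb_waitOrMove, ENNReal.ofReal_mul (Nat.cast_nonneg _), ENNReal.ofReal_natCast]
    simp only [this]
    rw [← ENNReal.ofReal_tsum_of_nonneg (fun k => by positivity) hs2.summable, hs2.tsum_eq,
      ENNReal.ofReal_ofNat]
  rw [Protocol.ect, hmass, hmean, tsub_self, mul_zero, add_zero]

/-- If the lower bound for the expected coordination time is attained at a stage in which only two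
rows have been selected, then both players pick each of these rows with probability `1 / 2`, and
the lower bound after one more round is the same. -/
theorem eq_of_ect_eq (h : IsPairHistory H a b) (hm6 : 6 ≤ m) (hP : P.IsStructural)
    (hect : P.ect (choiceMatching 2 m hm) H ≤ ENNReal.ofReal (lowerBound H)) :
    (∀ i c, rowProb P H i c = if c = a ∨ c = b then 1 / 2 else 0) ∧
      lowerBound H ≤
        1 + ∑ σ, P.profileProb (choiceMatching 2 m hm) H σ * lowerBound (σ :: H) := by
  have h1 := h.isSymmetry.lowerBound_add_le hP
  have h2 : 1 + ∑ σ, P.profileProb (choiceMatching 2 m hm) H σ * lowerBound (σ :: H) ≤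
      lowerBound H := (ENNReal.ofReal_le_ofReal_iff (lowerBound_nonneg H)).1
    ((P.le_ect_of_sum _ lowerBound lowerBound_nonneg (lowerBound_le_ect hP)
      h.isSymmetry.not_isFinal).trans hect)
  rw [h.card_compl_touched, if_pos (by omega), h.touched_eq] at h1
  have hx0 := rowProb_nonneg P H 0
  have hsum := sum_rowProb P H 0
  rw [← Finset.sum_add_sum_compl ({a, b} : Finset (Fin m)), Finset.sum_pair h.ne] at hsum
  rw [Finset.sum_pair h.ne, Equiv.swap_apply_left, Equiv.swap_apply_right] at h1
  have hD := sq_nonneg (rowProb P H 0 a - rowProb P H 0 b)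
  have hD' := sq_nonneg (rowProb P H 0 b - rowProb P H 0 a)
  have hR := sq_nonneg (∑ c ∈ ({a, b} : Finset (Fin m))ᶜ, rowProb P H 0 c)
  -- `h1` and `h2` squeeze the nonnegative slack to zero.
  have hr : ∑ c ∈ ({a, b} : Finset (Fin m))ᶜ, rowProb P H 0 c = 0 :=
    pow_eq_zero_iff two_ne_zero |>.1 (by linarith)
  have hab : rowProb P H 0 a - rowProb P H 0 b = 0 :=
    pow_eq_zero_iff two_ne_zero |>.1 (by linarith)
  have hzero : ∀ c, rowProb P H 0 c = if c = a ∨ c = b then 1 / 2 else 0 := by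
    intro c
    by_cases hc : c = a ∨ c = b
    · rw [if_pos hc]
      rcases hc with rfl | rfl <;> linarith
    · rw [if_neg hc]
      exact (Finset.sum_eq_zero_iff_of_nonneg fun c _ => hx0 c).1 hr c (by simpa using hc)
  refine ⟨fun i c => ?_, by linarith⟩
  match i with
  | 0 => exact hzero c
  | 1 =>
    rw [h.isSymmetry.rowProb_one hP, hzero]
    refine if_congr ?_ rfl rfl
    rw [Equiv.swap_apply_eq_iff, Equiv.swap_apply_eq_iff, Equiv.swap_apply_left,
      Equiv.swap_apply_right, or_comm]

end IsPairHistory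

/-! ### The first round, optimality and uniqueness. -/

theorem rowProb_nil (hP : P.IsStructural) (i : Fin 2) (c : Fin m) :
    rowProb P ([] : (choiceMatching 2 m hm).History) i c = 1 / m := by
  have h := sum_rowProb P ([] : (choiceMatching 2 m hm).History) i
  have ht : ∀ x, x ∉ touched ([] : (choiceMatching 2 m hm).History) := by simp [touched]
  rw [Finset.sum_congr rfl fun d _ => rowProb_eq_of_not_mem_touched hP i (ht d) (ht c)] at h
  simp only [Finset.sum_const, Finset.card_univ, Fintype.card_fin, nsmul_eq_mul] at h
  have : (m : ℝ) ≠ 0 := by exact_mod_cast hm.ne'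
  field_simp
  linarith

theorem not_isFinal_nil : ¬ (choiceMatching 2 m hm).IsFinal [] := by
  simp [IsFinal]

theorem sum_lowerBound_singleton (hm6 : 6 ≤ m) (hP : P.IsStructural) :
    1 + ∑ σ, P.profileProb (choiceMatching 2 m hm) [] σ * lowerBound [σ] = 3 - 2 / (m : ℝ) := by
  have h : ∀ c d : Fin m, lowerBound [pair hm c d] = 2 - if c = d then 2 else 0 := by
    intro c d
    by_cases hcd : c = d
    · rw [lowerBound_of_isFinal (isFinal_cons (σ := pair hm c d) hcd), if_pos hcd, sub_self]
    · rw [(isPairHistory_singleton (σ := pair hm c d) hcd).lowerBound_eq hm6, if_neg hcd, sub_zero]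
  have : (m : ℝ) ≠ 0 := by exact_mod_cast hm.ne'
  rw [sum_profile]
  simp only [profileProb_eq, rowProb_nil hP, h, ← Finset.mul_sum, Finset.sum_sub_distrib,
    Finset.sum_ite_eq, Finset.mem_univ, if_true, Finset.sum_const, Finset.card_univ,
    Fintype.card_fin, nsmul_eq_mul]
  field_simp
  ring

theorem ofReal_le_ect_nil (hm6 : 6 ≤ m) (hP : P.IsStructural) :
    ENNReal.ofReal (3 - 2 / (m : ℝ)) ≤ P.ect (choiceMatching 2 m hm) [] := by
  rw [← sum_lowerBound_singleton (hm := hm) hm6 hP]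
  exact P.le_ect_of_sum _ lowerBound lowerBound_nonneg (lowerBound_le_ect hP) not_isFinal_nil

theorem ect_waitOrMove_nil (hm6 : 6 ≤ m) :
    waitOrMove.ect (choiceMatching 2 m hm) [] = ENNReal.ofReal (3 - 2 / (m : ℝ)) := by
  have hnn : ∀ σ, 0 ≤ waitOrMove.profileProb (choiceMatching 2 m hm) [] σ * lowerBound [σ] :=
    fun σ => mul_nonneg (waitOrMove.profileProb_nonneg _ _ σ) (lowerBound_nonneg _)
  rw [← sum_lowerBound_singleton (hm := hm) hm6 waitOrMove_isStructural,
    ENNReal.ofReal_add zero_le_one (Finset.sum_nonneg fun σ _ => hnn σ), ENNReal.ofReal_one,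
    ENNReal.ofReal_sum_of_nonneg fun σ _ => hnn σ, Protocol.ect_of_not_isFinal _ _ not_isFinal_nil]
  congr 1
  refine Finset.sum_congr rfl fun σ _ => ?_
  rw [ENNReal.ofReal_mul (waitOrMove.profileProb_nonneg _ _ σ)]
  congr 1
  by_cases hσ : row σ 0 = row σ 1
  · rw [Protocol.ect_of_isFinal _ _ (isFinal_cons hσ), lowerBound_of_isFinal (isFinal_cons hσ),
      ENNReal.ofReal_zero]
  · have h := isPairHistory_singleton hσ
    rw [h.ect_waitOrMove, h.lowerBound_eq hm6, ENNReal.ofReal_ofNat]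

/-- Along the stages reached by wait-or-move, a protocol that is as fast as wait-or-move attains
the lower bound. -/
theorem eq_nil_or_isPairHistory_of_reachable (hm6 : 6 ≤ m) (hP : P.IsStructural)
    (hect : P.ect (choiceMatching 2 m hm) [] ≤ ENNReal.ofReal (3 - 2 / (m : ℝ)))
    (hH : waitOrMove.Reachable (choiceMatching 2 m hm) H)
    (hf : ¬ (choiceMatching 2 m hm).IsFinal H) :
    H = [] ∨ (∃ a b, IsPairHistory H a b) ∧
      P.ect (choiceMatching 2 m hm) H = ENNReal.ofReal (lowerBound H) := by
  induction hH with
  | initial => exact Or.inl rfl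
  | step H σ _ hH hσ ih =>
    right
    have hne : row σ 0 ≠ row σ 1 := fun e => hf (isFinal_cons e)
    rcases ih hH with rfl | ⟨⟨a, b, h⟩, he⟩
    · refine ⟨⟨_, _, isPairHistory_singleton hne⟩, ?_⟩
      refine P.ect_cons_eq _ lowerBound lowerBound_nonneg (lowerBound_le_ect hP) hH ?_ ?_
      · rwa [sum_lowerBound_singleton hm6 hP]
      · rw [profileProb_eq, rowProb_nil hP, rowProb_nil hP]
        positivity
    · obtain ⟨hrow, hle⟩ := h.eq_of_ect_eq hm6 hP he.le
      have hpos : 0 < P.profileProb (choiceMatching 2 m hm) H σ := by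
        rwa [profileProb_eq, h.rowProb_waitOrMove, h.rowProb_waitOrMove, ← hrow 0, ← hrow 1,
          ← profileProb_eq] at hσ
      refine ⟨⟨a, b, ?_⟩, P.ect_cons_eq _ lowerBound lowerBound_nonneg (lowerBound_le_ect hP) hH
        (he.le.trans (ENNReal.ofReal_le_ofReal hle)) hpos⟩
      rw [profileProb_eq, h.rowProb_waitOrMove, h.rowProb_waitOrMove] at hσ
      refine h.cons hne ?_ ?_
      · by_contra h0
        rw [if_neg h0, zero_mul] at hσ
        exact hσ.false
      · by_contra h1
        rw [if_neg h1, mul_zero] at hσ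
        exact hσ.false

end ChoiceMatching

open ChoiceMatching in
theorem mainTheorem3 (m : ℕ) (hm : 6 ≤ m) :
    waitOrMove.IsUniquelyECTOptimal (choiceMatching 2 m (by omega)) ∧
      waitOrMove.ect (choiceMatching 2 m (by omega)) [] = ENNReal.ofReal (3 - 2 / (m : ℝ)) := by
  refine ⟨⟨⟨waitOrMove_isStructural, fun Q hQ => ?_⟩, fun Q hQ H hH hf i c => ?_⟩,
    ect_waitOrMove_nil hm⟩
  · rw [ect_waitOrMove_nil hm]
    exact ofReal_le_ect_nil hm hQ
  · have hle := hQ.2 waitOrMove waitOrMove_isStructural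
    rw [ect_waitOrMove_nil hm] at hle
    rcases eq_nil_or_isPairHistory_of_reachable hm hQ.1 hle hH hf with rfl | ⟨⟨a, b, h⟩, he⟩
    · exact (rowProb_nil hQ.1 i c).trans (rowProb_nil waitOrMove_isStructural i c).symm
    · exact ((h.eq_of_ect_eq hm hQ.1 he.le).1 i c).trans (h.rowProb_waitOrMove i c).symm
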